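/- Let $R$ be a finite local commutative ring with identity, with radical $\mathrm{rad}(R)$, and put $I_0=\{x\in \mathrm{rad}(R): x\,\mathrm{rad}(R)=\{0\}\}$, an ideal of $R$, with natural epimorphism $\pi_0:R\to R/I_0$. Let $K\le R^\times$ be a pure group, i.e. the only ideal $I$ of $R$ with $K+I=K$ is $I=\{0\}$. Let $\mathcal C=\mathrm{Cyc}(K,R)$ be the cyclotomic scheme on $R$ whose basis relations are the relations $\{(x,y)\in R\times R: y-x\in rK\}$, $r\in R$. For a scheme $\mathcal S$ on a set $V$ denote by $\mathrm{Aut}(\mathcal S)$ the group of all permutations of $V$ that preserve each basis relation of $\mathcal S$. For a commutative ring $A$ let $\mathrm{A\Gamma L}_1(A)$ be the group of all permutations $x\mapsto a x^\sigma+b$ of $A$ with $a\in A^\times$, $b\in A$, $\sigma\in\mathrm{Aut}(A)$; a cyclotomic scheme $\mathcal S$ over $A$ is called normal if $\mathrm{Aut}(\mathcal S)\le \mathrm{A\Gamma L}_1(A)$. Let $\mathcal C_{R/I_0}$ be the factor-scheme of $\mathcal C$ on $R/I_0$, whose basis relations are the sets $\{(X,Y): S\cap(X\times Y)\neq\emptyset\}$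 of pairs of cosets of $I_0$, where $S$ runs over the basis relations of $\mathcal C$. Put $\mathrm{Aut}_{\mathcal C}(R)=\mathrm{Aut}(\mathcal C)\cap\mathrm{Aut}(R)$ and $\mathrm{Aut}_{\mathcal C}(R/I_0)=\mathrm{Aut}(\mathcal C_{R/I_0})\cap\mathrm{Aut}(R/I_0)$, and let $\mathrm{Aut}(\mathcal C)^{R/I_0}$ be the group of permutations of $R/I_0$ induced by $\mathrm{Aut}(\mathcal C)$. Then: 1. the natural mapping $\mathrm{Aut}_{\mathcal C}(R)\to\mathrm{Aut}_{\mathcal C}(R/I_0)$, taking $\sigma$ to the automorphism $\pi_0(x)\mapsto\pi_0(x^\sigma)$, is a well-defined group monomorphism; 2. if $\mathrm{Aut}(\mathcal C)^{R/I_0}\le\mathrm{A\Gamma L}_1(R/I_0)$, then $\mathrm{Aut}(\mathcal C)\le\mathrm{A\Gamma L}_1(R)$; 3. if the cyclotomic scheme $\mathrm{Cyc}(\pi_0(K),R/I_0)$ is normal, then $\mathcal C$ is normal. -/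

import Mathlib

open scoped Pointwise

namespace CycScheme

/-- A scheme on `V` is represented by its set `C` of basis relations. This is its automorphism
group: the permutations `f` of `V` with `S^f = S` for every basis relation `S`. -/
def aut {V : Type*} (C : Set (Set (V × V))) : Subgroup (Equiv.Perm V) where
  carrier := {f | ∀ S ∈ C, Prod.map f f '' S = S}
  one_mem' := by
    intro S _
    simp
  mul_mem' := by
    intro f g hf hg S hS
    have h : Prod.map (f * g) (f * g) = Prod.map f f ∘ Prod.map g g := by
      funext p
      simp [Prod.map]
    rw [h, Set.image_comp, hg S hS, hf S hS]
  inv_mem' := by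
    intro f hf S hS
    have h : Prod.map (f⁻¹ : Equiv.Perm V) (f⁻¹ : Equiv.Perm V) ∘ Prod.map f f = id := by
      funext p
      simp [Prod.map]
    conv_lhs => rw [← hf S hS]
    rw [← Set.image_comp, h, Set.image_id]

/-- The factor of a scheme along `p : V → W`. When `p` is the projection of `V` onto the set of
classes of an equivalence relation, the image of a relation `S` consists of the pairs `(X, Y)`
of classes for which `S ∩ (X × Y)` is nonempty. -/
def factor {V W : Type*} (p : V → W) (C : Set (Set (V × V))) : Set (Set (W × W)) :=
  (fun S => Prod.map p p '' S) '' C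

/-- The group of permutations of `W` induced by the elements of `G`, where `p : V → W` is the
projection onto the set of classes of a `G`-invariant equivalence relation. -/
def induced {V W : Type*} (p : V → W) (G : Subgroup (Equiv.Perm V)) :
    Subgroup (Equiv.Perm W) where
  carrier := {g | ∃ f ∈ G, ∀ x, g (p x) = p (f x)}
  one_mem' := ⟨1, G.one_mem, fun _ => rfl⟩
  mul_mem' := by
    rintro g g' ⟨f, hf, h⟩ ⟨f', hf', h'⟩
    refine ⟨f * f', G.mul_mem hf hf', fun x => ?_⟩
    rw [Equiv.Perm.mul_apply, h', h, Equiv.Perm.mul_apply]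
  inv_mem' := by
    rintro g ⟨f, hf, h⟩
    refine ⟨f⁻¹, G.inv_mem hf, fun x => ?_⟩
    rw [Equiv.Perm.inv_eq_iff_eq, h]
    exact congrArg p (f.apply_symm_apply x).symm

variable (R : Type*) [CommRing R]

/-- The group `AΓL₁(R)` of all permutations `x ↦ a x^σ + b` of `R`, where `a` is a unit, `b` is an
element and `σ` is an automorphism of the ring `R`. -/
def affineSemilinear : Subgroup (Equiv.Perm R) where
  carrier := {f | ∃ (a : Rˣ) (b : R) (σ : RingAut R), ∀ x, f x = a * σ x + b}
  one_mem' := ⟨1, 0, 1, fun x => by simp⟩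
  mul_mem' := by
    rintro f g ⟨a, b, σ, h⟩ ⟨c, d, τ, h'⟩
    refine ⟨a * Units.map (σ : R →* R) c, a * σ d + b, σ * τ, fun x => ?_⟩
    rw [Equiv.Perm.mul_apply, h', h, RingAut.mul_apply, map_add, map_mul]
    simp
    ring
  inv_mem' := by
    rintro f ⟨a, b, σ, h⟩
    refine ⟨Units.map ((σ⁻¹ : RingAut R) : R →* R) a⁻¹,
      -(σ⁻¹ : RingAut R) ((a⁻¹ : Rˣ) * b), σ⁻¹, fun x => ?_⟩
    rw [Equiv.Perm.inv_eq_iff_eq, h]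
    have e : ∀ y : R, σ ((σ⁻¹ : RingAut R) y) = y := fun y => σ.apply_symm_apply y
    simp only [map_add, map_neg, map_mul, Units.coe_map, MonoidHom.coe_coe, e]
    have e' : (a : R) * ((a⁻¹ : Rˣ) : R) = 1 := a.mul_inv
    linear_combination (b - x) * e'

/-- The ideal `I₀ = {x ∈ rad R : x · rad R = 0}`. -/
def I₀ : Ideal R where
  carrier := {x | x ∈ Ring.jacobson R ∧ ∀ y ∈ Ring.jacobson R, x * y = 0}
  zero_mem' := ⟨Ideal.zero_mem _, fun y _ => zero_mul y⟩
  add_mem' := by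
    rintro x x' ⟨hx, h⟩ ⟨hx', h'⟩
    exact ⟨Ideal.add_mem _ hx hx', fun y hy => by rw [add_mul, h y hy, h' y hy, add_zero]⟩
  smul_mem' := by
    rintro c x ⟨hx, h⟩
    exact ⟨Ideal.mul_mem_left _ c hx, fun y hy => by rw [smul_eq_mul, mul_assoc, h y hy, mul_zero]⟩

variable {R}

/-- `Rel(K, R)`, the set of basis relations of the cyclotomic scheme `Cyc(K, R)`: the relations
`{(x, y) : y - x ∈ rK}` with `r ∈ R`. -/
def cyc (K : Subgroup Rˣ) : Set (Set (R × R)) :=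
  Set.range fun r : R => {p : R × R | ∃ k ∈ K, p.2 - p.1 = r * (k : R)}

/-- `K` is pure: the only ideal `I` of `R` with `K + I = K` is the zero ideal. -/
def IsPure (K : Subgroup Rˣ) : Prop :=
  ∀ I : Ideal R, ((↑) '' (K : Set Rˣ) : Set R) + (I : Set R) = (↑) '' (K : Set Rˣ) → I = ⊥

/-- The scheme `Cyc(K, R)` is normal: `Aut(Cyc(K, R)) ≤ AΓL₁(R)`. -/
def IsNormal (K : Subgroup Rˣ) : Prop :=
  aut (cyc K) ≤ affineSemilinear R

/-- The group of the automorphisms of the ring `R` that are automorphisms of the scheme `C`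
on `R`. -/
def ringAut (C : Set (Set (R × R))) : Subgroup (RingAut R) :=
  (aut C).comap (RingAut.toPerm R)

/-- The image `π_I(K)` of `K` in the group of units of `R / I`. -/
def imageUnits (I : Ideal R) (K : Subgroup Rˣ) : Subgroup (R ⧸ I)ˣ :=
  K.map (Units.map (Ideal.Quotient.mk I : R →* R ⧸ I))

end CycScheme

namespace CycScheme

/-! Everything rests on one rigidity fact, `Preserves.exists_slope`: if `f` preserves the scheme and
is trivial modulo `I₀`, then `f x = (1 + c) x + f 0` with `1 + c ∈ K`. Here `d = f - id` takes
values in `I₀`, a vector space over the residue field `F`, and its quotients `(d x - d y) / (x - y)`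
at unit differences lie in the additive group `J = slopes K`. Purity says that `J` contains no
nonzero `F`-subspace. This forces `d` to factor through `F`, and `quotientsIn_le_affineIn` makes it
affine: unipotence of translations reduces to additive `d`, which Galois theory and independence of
characters show to be `F`-linear.

A ring automorphism trivial modulo `I₀` fixes `1`, so its slope is zero and it is the identity. For
the second claim, normalize `f` to fix `0` and `1`. Its failure to be additive or multiplicative is
measured by scheme-preserving maps trivial modulo `I₀`; these are affine, and purity and the
normalization make the defects vanish. The third claim follows since induced permutations preserve
the quotient cyclotomic scheme. -/

/-- Replacing `x` by `x + 1` shows that the two pairs also have equal sums, so `ρ x` is `ρ' x` or `τ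
x`. An additive group is not a union of two proper subgroups. -/
theorem ringHom_eq_of_mul_eq_mul {F : Type*} [Field F] {ρ τ ρ' τ' : F →+* F}
    (h : ∀ x, ρ x * τ' x = ρ' x * τ x) (hne : ρ ≠ τ) : ρ = ρ' ∧ τ = τ' := by
  have hs : ∀ x, ρ x + τ' x = ρ' x + τ x := by
    intro x
    have h1 := h (x + 1)
    simp only [map_add, map_one] at h1
    linear_combination h1 - h x
  have hor : ∀ x, ρ x = ρ' x ∨ ρ x = τ x := by
    intro x
    have : (ρ x - ρ' x) * (ρ x - τ x) = 0 := by
      linear_combination ρ x * hs x - h x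
    rcases mul_eq_zero.1 this with h | h
    · exact Or.inl (sub_eq_zero.1 h)
    · exact Or.inr (sub_eq_zero.1 h)
  have hex : ∃ x, ρ x ≠ τ x := by
    by_contra! hc
    exact hne (RingHom.ext hc)
  obtain ⟨x, hx⟩ := hex
  have e : ρ = ρ' := by
    ext y
    rcases hor y with h1 | h1
    · exact h1
    have hx' := (hor x).resolve_right hx
    have hxy : ρ (x + y) ≠ τ (x + y) := by
      simp only [map_add, h1]
      exact fun hc => hx (add_right_cancel hc)
    have h2 := (hor (x + y)).resolve_right hxy
    simp only [map_add, hx'] at h2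
    exact add_left_cancel h2
  refine ⟨e, ?_⟩
  ext y
  have := hs y
  rw [e] at this
  exact (add_left_cancel this).symm

/-! ### Bilinear forms on a Galois extension -/

section Galois

variable {k F : Type*} [Field k] [Field F] [Algebra k F] [FiniteDimensional k F] [IsGalois k F]

/-- The automorphisms are independent over `F`, and their number is the `F`-dimension of `F →ₗ[k]
F`. -/
theorem linearMap_eq_sum_aut (g : F →ₗ[k] F) :
    ∃ c : (F ≃ₐ[k] F) → F, ∀ x, g x = ∑ σ, c σ * σ x := by
  have hli : LinearIndependent F (fun σ : F ≃ₐ[k] F => (σ : F →ₐ[k] F).toLinearMap) :=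
    (linearIndependent_toLinearMap k F F).comp (fun σ : F ≃ₐ[k] F => (σ : F →ₐ[k] F))
      (fun σ τ h => AlgEquiv.ext fun x => DFunLike.congr_fun h x)
  have hcard : Fintype.card (F ≃ₐ[k] F) = Module.finrank F (F →ₗ[k] F) := by
    rw [Module.finrank_linearMap_self, ← IsGalois.card_aut_eq_finrank, Nat.card_eq_fintype_card]
  have hspan := hli.span_eq_top_of_card_eq_finrank' hcard
  have hg : g ∈ Submodule.span F
      (Set.range fun σ : F ≃ₐ[k] F => (σ : F →ₐ[k] F).toLinearMap) := hspan ▸ Submodule.mem_top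
  obtain ⟨c, hc⟩ := (Submodule.mem_span_range_iff_exists_fun F).1 hg
  refine ⟨c, fun x => ?_⟩
  rw [← hc]
  simp [LinearMap.sum_apply]

theorem bilin_eq_sum_aut (B : F →ₗ[k] F →ₗ[k] F) :
    ∃ β : (F ≃ₐ[k] F) × (F ≃ₐ[k] F) → F, ∀ y x, B y x = ∑ q, β q * (q.1 y * q.2 x) := by
  let b := Module.finBasis k F
  choose c hc using fun i => linearMap_eq_sum_aut (B (b i))
  choose e he using fun τ : F ≃ₐ[k] F => linearMap_eq_sum_aut
    (b.constr k (fun i => c i τ) : F →ₗ[k] F)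
  refine ⟨fun q => e q.2 q.1, fun y x => ?_⟩
  have h1 : B y x = ∑ τ, (b.constr k (fun i => c i τ) : F →ₗ[k] F) y * τ x := by
    conv_lhs => rw [← b.sum_repr y]
    simp only [map_sum, map_smul, LinearMap.sum_apply, LinearMap.smul_apply, hc,
      Module.Basis.constr_apply_fintype, Finset.sum_mul, Finset.smul_sum, smul_mul_assoc,
      Module.Basis.equivFun_apply]
    rw [Finset.sum_comm]
  rw [h1, Fintype.sum_prod_type, Finset.sum_comm]
  refine Finset.sum_congr rfl fun τ _ => ?_
  rw [he, Finset.sum_mul]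
  exact Finset.sum_congr rfl fun σ _ => by ring

/-- On pairs `(x⁻¹, x)` the term `σ y * τ x` becomes the character `τ x / σ x`. For `σ ≠ τ` no other
pair gives the same character, so independence kills its coefficient; the surviving diagonal terms
depend only on `y * x`. -/
theorem bilin_apply_eq_of_apply_inv_eq_zero (B : F →ₗ[k] F →ₗ[k] F)
    (hB : ∀ x, x ≠ 0 → B x⁻¹ x = 0) (y x : F) : B y x = B (y * x) 1 := by
  classical
  obtain ⟨β, hβ⟩ := bilin_eq_sum_aut B
  let χ : (F ≃ₐ[k] F) × (F ≃ₐ[k] F) → (Fˣ →* F) := fun q =>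
    { toFun := fun x => q.1 (x⁻¹ : Fˣ) * q.2 x
      map_one' := by simp
      map_mul' := fun x y => by simp; ring }
  have hχ : ∀ q q', q.1 ≠ q.2 → χ q' = χ q → q' = q := by
    intro q q' hq h
    have key : ∀ x, (q.2 : F →+* F) x * (q'.1 : F →+* F) x
        = (q'.2 : F →+* F) x * (q.1 : F →+* F) x := by
      intro x
      by_cases hx : x = 0
      · simp [hx]
      have h1 := DFunLike.congr_fun h (Units.mk0 x hx)
      simp only [χ, MonoidHom.coe_mk, OneHom.coe_mk, Units.val_inv_eq_inv_val, Units.val_mk0,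
        map_inv₀] at h1
      have hx1 : q.1 x ≠ 0 := by simpa using hx
      have hx2 : q'.1 x ≠ 0 := by simpa using hx
      field_simp at h1
      simp only [RingHom.coe_coe]
      linear_combination -h1
    have hne : (q.2 : F →+* F) ≠ (q.1 : F →+* F) := by
      intro hc
      exact hq (AlgEquiv.ext fun x => (DFunLike.congr_fun hc x).symm)
    obtain ⟨h1, h2⟩ := ringHom_eq_of_mul_eq_mul key hne
    exact Prod.ext (AlgEquiv.ext fun x => (DFunLike.congr_fun h2 x).symm)
      (AlgEquiv.ext fun x => (DFunLike.congr_fun h1 x).symm)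
  have hβ0 : ∀ q, q.1 ≠ q.2 → β q = 0 := by
    intro q hq
    have hli := linearIndependent_iff'.1 (linearIndependent_monoidHom Fˣ F)
      (Finset.univ.image χ) (fun ψ => ∑ q' with χ q' = ψ, β q') (by
        ext x
        have h1 := hB x x.ne_zero
        rw [hβ] at h1
        rw [Finset.sum_apply, Pi.zero_apply, ← h1,
          ← Finset.sum_fiberwise_of_maps_to (s := Finset.univ) (t := Finset.univ.image χ) (g := χ)
            (fun q _ => Finset.mem_image_of_mem χ (Finset.mem_univ q))]
        refine Finset.sum_congr rfl fun ψ _ => ?_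
        simp only [Pi.smul_apply, smul_eq_mul, Finset.sum_mul]
        refine Finset.sum_congr rfl fun q' hq' => ?_
        rw [← (Finset.mem_filter.1 hq').2]
        simp [χ])
      (χ q) (Finset.mem_image_of_mem χ (Finset.mem_univ q))
    have hf : (Finset.univ.filter fun q' => χ q' = χ q) = {q} := by
      ext q'
      simp only [Finset.mem_filter, Finset.mem_univ, true_and, Finset.mem_singleton]
      exact ⟨hχ q q' hq, fun h => by rw [h]⟩
    simpa [hf] using hli
  rw [hβ, hβ]
  refine Finset.sum_congr rfl fun q _ => ?_
  by_cases hq : q.1 = q.2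
  · rw [hq]; simp
  · simp [hβ0 q hq]

end Galois

/-! ### Functions on a finite field with restricted difference quotients -/

section Field

variable {F M : Type*} [Field F] [AddCommGroup M] [Module F M] {J : AddSubgroup M}

theorem addMonoidHom_eq_smul_of_inv_smul_mem [Finite F] (hJ : ∀ m : M, (∀ a : F, a • m ∈ J) → m = 0)
    (d : F →+ M) (hd : ∀ x, x ≠ 0 → x⁻¹ • d x ∈ J) (x : F) : d x = x • d 1 := by
  obtain ⟨p, hp⟩ := CharP.exists F
  have : Fact p.Prime := ⟨CharP.char_is_prime F p⟩
  let : Algebra (ZMod p) F := ZMod.algebra F p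
  let : Module (ZMod p) M := Module.compHom M (algebraMap (ZMod p) F)
  have : IsScalarTower (ZMod p) F M := ⟨fun a b m => by
    rw [Algebra.smul_def, mul_smul]; rfl⟩
  have : FiniteDimensional (ZMod p) F := Module.Finite.of_finite
  rw [← sub_eq_zero]
  refine hJ _ fun y => ?_
  by_contra hy
  -- A functional to the prime field that kills `J` but not this vector turns `hd` into the
  -- vanishing of a bilinear form on pairs `(x⁻¹, x)`.
  obtain ⟨l, hl, hlJ⟩ := Submodule.exists_le_ker_of_notMem
    (p := AddSubgroup.toZModSubmodule p J) (v := y • (d x - x • d 1)) hy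
  let B : F →ₗ[ZMod p] F →ₗ[ZMod p] F := LinearMap.mk₂ (ZMod p)
    (fun y x => algebraMap (ZMod p) F (l (y • d x)))
    (fun a b c => by rw [add_smul, map_add, map_add])
    (fun a b c => by rw [smul_assoc, map_smul, smul_eq_mul, map_mul, Algebra.smul_def])
    (fun a b c => by rw [map_add, smul_add, map_add, map_add])
    (fun a b c => by
      rw [ZMod.map_smul, smul_comm, map_smul, smul_eq_mul, map_mul, Algebra.smul_def])
  have hB := bilin_apply_eq_of_apply_inv_eq_zero B (fun x hx => by
    have : l (x⁻¹ • d x) = 0 := hlJ (hd x hx)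
    simp [B, this]) y x
  have h2 := (algebraMap (ZMod p) F).injective hB
  apply hl
  rw [smul_sub, map_sub, h2, mul_smul, sub_self]

variable (F J) in
/-- The functions from `F` to `M` all of whose difference quotients lie in `J`. -/
def quotientsIn : AddSubgroup (F → M) where
  carrier := {d | ∀ x y, x ≠ y → (x - y)⁻¹ • (d x - d y) ∈ J}
  zero_mem' := fun x y _ => by simp
  add_mem' := fun {d e} hd he x y hxy => by
    have := J.add_mem (hd x y hxy) (he x y hxy)
    rwa [← smul_add, sub_add_sub_comm] at this
  neg_mem' := fun {d} hd x y hxy => by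
    have := J.neg_mem (hd x y hxy)
    rwa [← smul_neg, neg_sub'] at this

variable (F J) in
/-- The affine functions from `F` to `M` with slope in `J`. -/
def affineIn : AddSubgroup (F → M) where
  carrier := {d | ∃ c ∈ J, ∃ b, ∀ x, d x = x • c + b}
  zero_mem' := ⟨0, J.zero_mem, 0, fun x => by simp⟩
  add_mem' := by
    rintro d e ⟨c, hc, b, h⟩ ⟨c', hc', b', h'⟩
    exact ⟨c + c', J.add_mem hc hc', b + b', fun x => by
      rw [Pi.add_apply, h, h', smul_add]; abel⟩
  neg_mem' := by
    rintro d ⟨c, hc, b, h⟩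
    exact ⟨-c, J.neg_mem hc, -b, fun x => by rw [Pi.neg_apply, h, smul_neg]; abel⟩

variable (F M) in
/-- Translation of the argument. -/
def shift (t : F) : Module.End F (F → M) where
  toFun d x := d (x + t)
  map_add' _ _ := rfl
  map_smul' _ _ := rfl

theorem shift_pow_apply (t : F) (n : ℕ) (d : F → M) (x : F) :
    (shift F M t ^ n) d x = d (x + n * t) := by
  induction n generalizing d with
  | zero => simp
  | succ n ih =>
    rw [pow_succ, Module.End.mul_apply, ih]
    simp only [shift, LinearMap.coe_mk, AddHom.coe_mk]
    congr 1
    push_cast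
    ring

theorem shift_commute (s t : F) : Commute (shift F M s) (shift F M t) := by
  ext d x
  simp [shift, add_right_comm]

/-- In characteristic `p`, `(S - 1) ^ p = S ^ p - 1 = 0`. -/
theorem exists_shift_sub_one_pow_eq_zero [Finite F] (t : F) : ∃ n : ℕ, (shift F M t - 1) ^ n = 0 := by
  obtain ⟨p, hp⟩ := CharP.exists F
  have hpp : p.Prime := CharP.char_is_prime F p
  refine ⟨p, ?_⟩
  obtain ⟨r, hr⟩ := (Commute.one_right (shift F M t - 1)).exists_add_pow_prime_eq hpp
  have h1 : shift F M t ^ p = 1 := by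
    ext d x
    simp [shift_pow_apply]
  have h0 : (p : Module.End F (F → M)) = 0 := by
    rw [← map_natCast (algebraMap F (Module.End F (F → M))), CharP.cast_eq_zero, map_zero]
  simpa [h1, h0] using hr

theorem shift_sub_one_pow_mem {W : AddSubgroup (F → M)} {t : F}
    (hW : ∀ d ∈ W, (shift F M t - 1) d ∈ W) (n : ℕ) {d : F → M} (hd : d ∈ W) :
    ((shift F M t - 1) ^ n) d ∈ W := by
  induction n with
  | zero => exact hd
  | succ n ih => rw [pow_succ', Module.End.mul_apply]; exact hW _ ih

/-- A commuting family of unipotent operators has a nonzero fixed vector modulo `W`: for each new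
`t`, take the last iterate outside `W`. -/
theorem exists_shift_sub_one_mem [Finite F] {V W : AddSubgroup (F → M)}
    (hV : ∀ t, ∀ d ∈ V, (shift F M t - 1) d ∈ V) (hW : ∀ t, ∀ d ∈ W, (shift F M t - 1) d ∈ W)
    {d : F → M} (hd : d ∈ V) (hdW : d ∉ W) (s : Finset F) :
    ∃ g ∈ V, g ∉ W ∧ ∀ t ∈ s, (shift F M t - 1) g ∈ W := by
  classical
  induction s using Finset.induction_on with
  | empty => exact ⟨d, hd, hdW, by simp⟩
  | insert a s _ ih =>
    obtain ⟨g, hg, hgW, hs⟩ := ih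
    have hex : ∃ n : ℕ, ((shift F M a - 1) ^ n) g ∈ W := by
      obtain ⟨n, hn⟩ := exists_shift_sub_one_pow_eq_zero (M := M) a
      exact ⟨n, by rw [hn]; exact W.zero_mem⟩
    have hn0 : Nat.find hex ≠ 0 := by
      intro h0
      have := Nat.find_spec hex
      rw [h0] at this
      exact hgW this
    obtain ⟨n, hn⟩ := Nat.exists_eq_succ_of_ne_zero hn0
    refine ⟨((shift F M a - 1) ^ n) g, shift_sub_one_pow_mem (hV a) n hg,
      Nat.find_min hex (by omega), fun t ht => ?_⟩
    rcases Finset.mem_insert.1 ht with rfl | ht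
    · have := Nat.find_spec hex
      rwa [hn, pow_succ', Module.End.mul_apply] at this
    · have hc : Commute (shift F M t - 1) ((shift F M a - 1) ^ n) :=
        (((shift_commute t a).sub_left (Commute.one_left _)).sub_right
          (Commute.one_right _)).pow_right n
      rw [← Module.End.mul_apply, hc.eq, Module.End.mul_apply]
      exact shift_sub_one_pow_mem (hW a) n (hs t ht)

theorem quotientsIn_le_affineIn [Finite F] (hJ : ∀ m : M, (∀ a : F, a • m ∈ J) → m = 0) :
    quotientsIn F J ≤ affineIn F J := by
  intro d hd
  by_contra hdW
  have := Fintype.ofFinite F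
  obtain ⟨g, hg, hgW, ht⟩ := exists_shift_sub_one_mem (V := quotientsIn F J) (W := affineIn F J)
    (by
      intro t d hd
      refine (quotientsIn F J).sub_mem (fun x y hxy => ?_) hd
      simpa [shift] using hd (x + t) (y + t) (by simpa using hxy))
    (by
      rintro t d ⟨c, hc, b, h⟩
      refine ⟨0, J.zero_mem, t • c, fun x => ?_⟩
      simp [shift, h, add_smul])
    hd hdW Finset.univ
  choose c hc b hb using fun t => ht t (Finset.mem_univ t)
  simp only [shift, LinearMap.sub_apply, LinearMap.coe_mk, AddHom.coe_mk, Module.End.one_apply,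
    Pi.sub_apply] at hb
  have hb' : ∀ t x, g (x + t) - g x - g t + g 0 = x • c t := by
    intro t x
    have h0 := hb t 0
    rw [zero_smul, zero_add, zero_add] at h0
    rw [hb t x, ← h0]
    abel
  -- The second difference in `hb'` is symmetric in `t` and `x`.
  have hct : ∀ t, c t = t • c 1 := by
    intro t
    have h1 := hb' t 1
    have h2 := hb' 1 t
    rw [one_smul] at h1
    rw [← h1, ← h2, add_comm t 1]
    abel
  -- All multiples of `c 1` are slopes in `J`, so `g - g 0` is additive.
  have hc1 : c 1 = 0 := hJ _ fun a => hct a ▸ hc a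
  have hadd : ∀ x t, g (x + t) - g 0 = (g x - g 0) + (g t - g 0) := by
    intro x t
    have h1 := hb' t x
    rw [hct, hc1, smul_zero, smul_zero] at h1
    rw [← sub_eq_zero, ← h1]
    abel
  have hlin := addMonoidHom_eq_smul_of_inv_smul_mem hJ
    (AddMonoidHom.mk' (fun x => g x - g 0) hadd) (fun x hx => by
      simpa using hg x 0 hx)
  refine hgW ⟨g 1 - g 0, by simpa using hg 1 0 one_ne_zero, g 0, fun x => ?_⟩
  have := hlin x
  simp only [AddMonoidHom.mk'_apply] at this
  rw [← this]
  abel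

end Field

/-! ### Scheme-preserving maps and purity -/

section Scheme

variable {R : Type*} [CommRing R]

/-- `f` maps every pair of the relation `rK` to a pair of the same relation. -/
def Preserves (K : Subgroup Rˣ) (f : R → R) : Prop :=
  ∀ x y, ∃ k ∈ K, f x - f y = (x - y) * (k : R)

variable {K : Subgroup Rˣ}

theorem mem_aut_cyc {f : Equiv.Perm R} : f ∈ aut (cyc K) ↔ Preserves K f := by
  constructor
  · intro hf x y
    have h : (f y, f x) ∈ {p : R × R | ∃ k ∈ K, p.2 - p.1 = (x - y) * (k : R)} := by
      have hS := hf _ ⟨x - y, rfl⟩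
      simp only at hS
      rw [← hS]
      exact ⟨(y, x), ⟨1, K.one_mem, by simp⟩, rfl⟩
    exact h
  · rintro hf _ ⟨r, rfl⟩
    ext ⟨a, b⟩
    constructor
    · rintro ⟨⟨x, y⟩, ⟨k, hk, h⟩, h'⟩
      simp only [Prod.map_apply, Prod.mk.injEq] at h'
      obtain ⟨l, hl, h''⟩ := hf y x
      refine ⟨k * l, K.mul_mem hk hl, ?_⟩
      simp only at h
      simp only [← h'.1, ← h'.2, h'', h, Units.val_mul]
      ring
    · rintro ⟨k, hk, h⟩
      simp only at h
      obtain ⟨l, hl, h'⟩ := hf (f.symm b) (f.symm a)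
      refine ⟨(f.symm a, f.symm b), ⟨k * l⁻¹, K.mul_mem hk (K.inv_mem hl), ?_⟩, by simp⟩
      rw [f.apply_symm_apply, f.apply_symm_apply, h] at h'
      simp only [Units.val_mul]
      have := l.mul_inv
      linear_combination (f.symm a - f.symm b) * this - h' * ((l⁻¹ : Rˣ) : R)

namespace Preserves

variable {f g : R → R}

theorem comp (hf : Preserves K f) (hg : Preserves K g) : Preserves K (fun x => f (g x)) := by
  intro x y
  obtain ⟨k, hk, h⟩ := hf (g x) (g y)
  obtain ⟨l, hl, h'⟩ := hg x y
  exact ⟨l * k, K.mul_mem hl hk, by rw [h, h', Units.val_mul, mul_assoc]⟩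

theorem of_rightInverse (hf : Preserves K f) (h : ∀ x, f (g x) = x) : Preserves K g := by
  intro x y
  obtain ⟨k, hk, h'⟩ := hf (g x) (g y)
  refine ⟨k⁻¹, K.inv_mem hk, ?_⟩
  rw [h, h] at h'
  rw [h', mul_assoc, k.mul_inv, mul_one]

theorem injective (hf : Preserves K f) : Function.Injective f := by
  intro x y h
  obtain ⟨k, _, h'⟩ := hf x y
  rw [h, sub_self] at h'
  exact sub_eq_zero.1 (k.mul_left_eq_zero.1 h'.symm)

theorem add_const (hf : Preserves K f) (b : R) : Preserves K (fun x => f x + b) := by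
  intro x y
  simpa using hf x y

theorem sub_mem (hf : Preserves K f) {I : Ideal R} {x y : R} (h : x - y ∈ I) :
    f x - f y ∈ I := by
  obtain ⟨k, _, h'⟩ := hf x y
  rw [h']
  exact I.mul_mem_right _ h

end Preserves

variable (K) in
/-- The elements `c` of `I₀` with `1 + c ∈ K`. -/
def slopes : AddSubgroup (I₀ R) where
  carrier := {c | ∃ k ∈ K, (k : R) = 1 + c}
  zero_mem' := ⟨1, K.one_mem, by simp⟩
  add_mem' := by
    rintro c c' ⟨k, hk, h⟩ ⟨k', hk', h'⟩
    refine ⟨k * k', K.mul_mem hk hk', ?_⟩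
    have : (c : R) * c' = 0 := c.2.2 _ c'.2.1
    rw [Units.val_mul, h, h', Submodule.coe_add]
    linear_combination this
  neg_mem' := by
    rintro c ⟨k, hk, h⟩
    refine ⟨k⁻¹, K.inv_mem hk, ?_⟩
    have : (c : R) * c = 0 := c.2.2 _ c.2.1
    have h' := k.mul_inv
    rw [h] at h'
    rw [Submodule.coe_neg]
    linear_combination (1 - (c : R)) * h' + ((k⁻¹ : Rˣ) : R) * this

/-- Since `k + a c = k (1 + k⁻¹ a c)`, the ideal generated by `c` is absorbed by `K`. -/
theorem IsPure.eq_zero_of_smul_mem_slopes (hK : IsPure K) {c : I₀ R}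
    (h : ∀ a : R, a • c ∈ slopes K) : c = 0 := by
  have hI : Ideal.span {(c : R)} = ⊥ := by
    refine hK _ (Set.Subset.antisymm ?_ fun x hx => ⟨x, hx, 0, Ideal.zero_mem _, add_zero x⟩)
    rintro _ ⟨_, ⟨k, hk, rfl⟩, y, hy, rfl⟩
    obtain ⟨a, rfl⟩ := Ideal.mem_span_singleton'.1 hy
    obtain ⟨l, hl, e⟩ := h (((k⁻¹ : Rˣ) : R) * a)
    refine ⟨k * l, K.mul_mem hk hl, ?_⟩
    simp only [Submodule.coe_smul, smul_eq_mul] at e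
    have := k.mul_inv
    simp only [Units.val_mul, e]
    linear_combination a * (c : R) * this
  exact Subtype.ext (Ideal.span_singleton_eq_bot.1 hI)

end Scheme

/-! ### Rigidity modulo `I₀` over a finite local ring -/

section Local

open IsLocalRing

variable {R : Type*} [CommRing R] [IsLocalRing R] {K : Subgroup Rˣ}

theorem smul_I₀_eq_zero {a : R} (ha : a ∈ maximalIdeal R) (c : I₀ R) : a • c = 0 := by
  apply Subtype.ext
  rw [← ringJacobson_eq_maximalIdeal] at ha
  simpa [mul_comm] using c.2.2 a ha

variable (R) in
/-- The vector space structure of `I₀` over the residue field. -/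
abbrev moduleResidueField : Module (ResidueField R) (I₀ R) :=
  Module.IsTorsionBySet.module (R := R) (I := maximalIdeal R)
    (fun c a => smul_I₀_eq_zero a.2 c)

theorem exists_slope [Finite R] (hK : IsPure K) {d : R → I₀ R}
    (hd : ∀ x y, IsUnit (x - y) → ∃ c ∈ slopes K, d x - d y = (x - y) • c) :
    ∃ c ∈ slopes K, ∀ x, d x = x • c + d 0 := by
  have hconst : ∀ x y, x - y ∈ maximalIdeal R → d x = d y := by
    intro x y hxy
    rw [← sub_eq_zero]
    refine hK.eq_zero_of_smul_mem_slopes fun a => ?_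
    by_cases ha : IsUnit a
    · obtain ⟨a, rfl⟩ := ha
      -- Compare `x` and `y` with a third point at unit distance from both, chosen so that `a • (d x
      -- - d y)` is a difference of slopes.
      obtain ⟨c, hc, h⟩ := hd x (x - (a⁻¹ : Rˣ)) (by simp)
      have hu : y - (x - (a⁻¹ : Rˣ)) = (a⁻¹ : Rˣ) - (x - y) := by ring
      obtain ⟨c', hc', h'⟩ := hd y (x - (a⁻¹ : Rˣ)) (by
        rw [hu]
        by_contra hn
        have := (maximalIdeal R).add_mem ((mem_maximalIdeal _).2 hn) hxy
        rw [sub_add_cancel] at this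
        exact (mem_maximalIdeal _).1 this (Units.isUnit _))
      rw [sub_sub_cancel] at h
      rw [hu, sub_smul, smul_I₀_eq_zero hxy, sub_zero] at h'
      have e : (a : R) • (d x - d y) = c - c' := by
        rw [← sub_sub_sub_cancel_right (d x) (d y) (d (x - (a⁻¹ : Rˣ))), h, h', ← smul_sub,
          smul_smul, a.mul_inv, one_smul]
      rw [e]
      exact (slopes K).sub_mem hc hc'
    · rw [smul_I₀_eq_zero ((mem_maximalIdeal a).2 ha)]
      exact (slopes K).zero_mem
  let _ := moduleResidueField R
  have hsmul : ∀ (a : R) (c : I₀ R), residue R a • c = a • c := fun a c =>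
    Module.IsTorsionBySet.mk_smul (fun c a => smul_I₀_eq_zero a.2 c) a c
  have : Finite (ResidueField R) := Finite.of_surjective _ residue_surjective
  let s := Function.surjInv (residue_surjective (R := R))
  have hs : ∀ X, residue R (s X) = X := Function.surjInv_eq _
  have hmem : (fun X => d (s X)) ∈ quotientsIn (ResidueField R) (slopes K) := by
    intro X Y hXY
    have hr : residue R (s X - s Y) = X - Y := by rw [map_sub, hs, hs]
    obtain ⟨c, hc, h⟩ := hd (s X) (s Y) (by
      by_contra hn
      have := (residue_eq_zero_iff _).2 ((mem_maximalIdeal _).2 hn)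
      rw [hr] at this
      exact hXY (sub_eq_zero.1 this))
    simp only [h]
    rw [← hsmul, hr, smul_smul, inv_mul_cancel₀ (sub_ne_zero.2 hXY), one_smul]
    exact hc
  obtain ⟨c, hc, b, h⟩ := quotientsIn_le_affineIn (fun m hm =>
    hK.eq_zero_of_smul_mem_slopes fun a => hsmul a m ▸ hm _) hmem
  have hx : ∀ x, d x = x • c + b := by
    intro x
    rw [← hsmul, ← h]
    refine hconst _ _ ?_
    rw [← residue_eq_zero_iff, map_sub, hs, sub_self]
  refine ⟨c, hc, fun x => ?_⟩
  rw [hx, hx 0, zero_smul, zero_add]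

/-- The automorphisms acting trivially modulo `I₀` are affine. -/
theorem Preserves.exists_slope [Finite R] (hK : IsPure K) {f : R → R} (hf : Preserves K f)
    (h : ∀ x, f x - x ∈ I₀ R) : ∃ c ∈ slopes K, ∀ x, f x = x + x * c + f 0 := by
  obtain ⟨c, hc, hx⟩ := CycScheme.exists_slope hK (d := fun x => ⟨f x - x, h x⟩) (by
    intro x y hu
    obtain ⟨k, hk, e⟩ := hf x y
    obtain ⟨u, hu⟩ := hu
    have hc : (k : R) - 1 = ((u⁻¹ : Rˣ) : R) * ((f x - x) - (f y - y)) := by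
      have h1 := u.mul_inv
      have e' : (f x - x) - (f y - y) = u * ((k : R) - 1) := by rw [hu]; linear_combination e
      rw [e', ← mul_assoc, u.inv_mul, one_mul]
    refine ⟨⟨(k : R) - 1, hc ▸ (I₀ R).mul_mem_left _ ((I₀ R).sub_mem (h x) (h y))⟩,
      ⟨k, hk, by simp⟩, Subtype.ext ?_⟩
    simp only [Submodule.coe_sub, Submodule.coe_smul, smul_eq_mul]
    linear_combination e)
  refine ⟨c, hc, fun x => ?_⟩
  have := congrArg Subtype.val (hx x)
  simp only [Submodule.coe_add, Submodule.coe_smul, smul_eq_mul] at this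
  linear_combination this

/-- A ring automorphism preserving the scheme is determined by its action modulo `I₀`. -/
theorem eq_one_of_sub_mem_I₀ [Finite R] (hK : IsPure K) {σ : RingAut R}
    (hσ : Preserves K σ) (h : ∀ x, σ x - x ∈ I₀ R) : σ = 1 := by
  obtain ⟨c, _, hc⟩ := hσ.exists_slope hK h
  have h1 := hc 1
  rw [map_one, map_zero] at h1
  have hc0 : (c : R) = 0 := by linear_combination -h1
  ext x
  rw [hc, hc0, map_zero]
  simp

theorem Preserves.map_add [Finite R] (hK : IsPure K) {f : R → R} (hf : Preserves K f)
    (h0 : f 0 = 0) (h1 : f 1 = 1) (hadd : ∀ x y, f (x + y) - f x - f y ∈ I₀ R) (x y : R) :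
    f (x + y) = f x + f y := by
  obtain ⟨g, hg⟩ := (Finite.injective_iff_surjective.1 hf.injective).hasRightInverse
  have hgf : ∀ x, g (f x) = x := fun x => hf.injective (hg (f x))
  have key : ∀ r, ∃ c ∈ slopes K, ∀ x, f (x + r) = f x + f x * c + f r := by
    intro r
    -- Conjugating translation by `r` with `f` and correcting by `f r` gives a map trivial modulo
    -- `I₀`.
    have hn : Preserves K (fun x => f (g x + r) + -f r) :=
      (hf.comp ((hf.of_rightInverse hg).add_const r)).add_const _
    obtain ⟨c, hc, h⟩ := hn.exists_slope hK (fun x => by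
      have := hadd (g x) r
      rw [hg] at this
      convert this using 1
      ring)
    refine ⟨c, hc, fun x => ?_⟩
    have e := h (f x)
    have hg0 : g 0 = 0 := by rw [← h0, hgf, h0]
    simp only [hgf, hg0, zero_add] at e
    linear_combination e
  choose c hc h using key
  have hcf : ∀ r, (c r : R) = f r * c 1 := by
    intro r
    have e1 := h r 1
    have e2 := h 1 r
    rw [h1] at e1 e2
    rw [add_comm 1 r] at e1
    linear_combination e2 - e1
  -- As `f` is onto, every multiple of `c 1` is some `c r`, hence a slope.
  have hc1 : c 1 = 0 := hK.eq_zero_of_smul_mem_slopes fun a => by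
    have e : a • c 1 = c (g a) := Subtype.ext (by rw [hcf, hg]; rfl)
    rw [e]
    exact hc _
  rw [h, hcf, hc1]
  simp

theorem Preserves.map_mul [Finite R] (hK : IsPure K) {f : R → R} (hf : Preserves K f)
    (h0 : f 0 = 0) (h1 : f 1 = 1) (hadd : ∀ x y, f (x + y) - f x - f y ∈ I₀ R)
    (hmul : ∀ x y, f (x * y) - f x * f y ∈ I₀ R) (x y : R) : f (x * y) = f x * f y := by
  have hf_add := hf.map_add hK h0 h1 hadd
  obtain ⟨g, hg⟩ := (Finite.injective_iff_surjective.1 hf.injective).hasRightInverse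
  have hgf : ∀ x, g (f x) = x := fun x => hf.injective (hg (f x))
  have key : ∀ (u : Rˣ) (y : R), f (u * y) = f u * f y := by
    intro u y
    obtain ⟨k, hk, hu⟩ := hf u 0
    rw [h0, sub_zero, sub_zero] at hu
    have hku := (u * k).inv_mul
    rw [Units.val_mul] at hku
    -- As `f u = u * k`, this conjugated multiplication by `u`, divided by `f u`, is trivial modulo
    -- `I₀`; it fixes `0` and `1`, so its slope is zero.
    have hn : Preserves K (fun x => (((u * k)⁻¹ : Rˣ) : R) * f (u * g x)) := by
      intro x y
      obtain ⟨l, hl, e⟩ := hf (u * g x) (u * g y)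
      obtain ⟨m, hm, e'⟩ := (hf.of_rightInverse hg) x y
      refine ⟨k⁻¹ * (m * l), K.mul_mem (K.inv_mem hk) (K.mul_mem hm hl), ?_⟩
      rw [← mul_sub, e, ← mul_sub, e', mul_inv]
      have := u.inv_mul
      simp only [Units.val_mul]
      linear_combination ((k⁻¹ : Rˣ) : R) * (x - y) * m * l * this
    obtain ⟨c, hc, h⟩ := hn.exists_slope hK (fun x => by
      have e : (((u * k)⁻¹ : Rˣ) : R) * f (u * g x) - x
          = (((u * k)⁻¹ : Rˣ) : R) * (f (u * g x) - f u * f (g x)) := by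
        rw [hg, hu]
        linear_combination x * hku
      rw [e]
      exact (I₀ R).mul_mem_left _ (hmul _ _))
    have hg0 : g 0 = 0 := by rw [← h0, hgf, h0]
    have hg1 : g 1 = 1 := by rw [← h1, hgf, h1]
    have e1 := h 1
    have e2 := h (f y)
    simp only [hg0, hg1, hgf, mul_zero, mul_one, h0, hu, hku, add_zero, one_mul] at e1 e2
    have hc0 : (c : R) = 0 := by linear_combination -e1
    rw [hc0] at e2
    rw [hu]
    have hku' := (u * k).mul_inv
    rw [Units.val_mul] at hku'
    linear_combination (u : R) * k * e2 - f (u * y) * hku'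
  -- One of `x`, `1 + x` is a unit, and additivity passes from `1 + x` to `x`.
  rcases IsLocalRing.isUnit_or_isUnit_one_sub_self (-x) with hx | hx
  · obtain ⟨u, hu⟩ := hx.neg
    rw [neg_neg] at hu
    rw [← hu, key]
  · rw [sub_neg_eq_add] at hx
    obtain ⟨u, hu⟩ := hx
    have := key u y
    rw [hu, add_mul, hf_add, hf_add, one_mul, h1] at this
    linear_combination this

theorem aut_le_affineSemilinear [Finite R] (hK : IsPure K)
    (h : induced (Ideal.Quotient.mk (I₀ R)) (aut (cyc K)) ≤ affineSemilinear (R ⧸ I₀ R)) :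
    aut (cyc K) ≤ affineSemilinear R := by
  intro f hf
  have hfp := mem_aut_cyc.1 hf
  have hsurj := Ideal.Quotient.mk_surjective (I := I₀ R)
  have hlift : ∀ x, Ideal.Quotient.mk (I₀ R)
      (f (Function.surjInv hsurj (Ideal.Quotient.mk (I₀ R) x))) = Ideal.Quotient.mk (I₀ R) (f x) := by
    intro x
    rw [Ideal.Quotient.eq]
    refine hfp.sub_mem ?_
    rw [← Ideal.Quotient.eq, Function.surjInv_eq hsurj]
  let F : R ⧸ I₀ R → R ⧸ I₀ R := fun X => Ideal.Quotient.mk (I₀ R) (f (Function.surjInv hsurj X))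
  have hFs : Function.Surjective F := by
    intro Y
    obtain ⟨y, rfl⟩ := hsurj Y
    exact ⟨Ideal.Quotient.mk (I₀ R) (f.symm y), by simp only [F, hlift, f.apply_symm_apply]⟩
  have : Finite (R ⧸ I₀ R) := Finite.of_surjective _ hsurj
  obtain ⟨a, b, τ, hτ⟩ := h (x := Equiv.ofBijective F
    ⟨Finite.injective_iff_surjective.2 hFs, hFs⟩) ⟨f, hf, hlift⟩
  have hτ' : ∀ x, Ideal.Quotient.mk (I₀ R) (f x) = a * τ (Ideal.Quotient.mk (I₀ R) x) + b :=
    fun x => (hlift x).symm.trans (hτ _)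
  -- `k = f 1 - f 0` lies in `K` and lifts `a`, so dividing by it keeps the scheme preserved and
  -- leaves a map inducing `τ`.
  obtain ⟨k, hk, e⟩ := hfp 1 0
  rw [sub_zero, one_mul] at e
  have hb := hτ' 0
  have ha := hτ' 1
  rw [RingHom.map_zero, map_zero τ, mul_zero, zero_add] at hb
  rw [RingHom.map_one, map_one τ, mul_one, ← hb] at ha
  have hak : (a : R ⧸ I₀ R) = Ideal.Quotient.mk (I₀ R) k := by
    rw [← e, map_sub, ha, add_sub_cancel_right]
  let g : R → R := fun x => ((k⁻¹ : Rˣ) : R) * (f x - f 0)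
  have hgk : ∀ x, f x = k * g x + f 0 := by
    intro x
    simp only [g]
    have := k.mul_inv
    linear_combination -(f x - f 0) * this
  have hg : Preserves K g := by
    intro x y
    obtain ⟨l, hl, e⟩ := hfp x y
    refine ⟨k⁻¹ * l, K.mul_mem (K.inv_mem hk) hl, ?_⟩
    simp only [g, Units.val_mul]
    linear_combination ((k⁻¹ : Rˣ) : R) * e
  have hg0 : g 0 = 0 := by simp [g]
  have hg1 : g 1 = 1 := by simp [g, e]
  have hgτ : ∀ x, Ideal.Quotient.mk (I₀ R) (g x) = τ (Ideal.Quotient.mk (I₀ R) x) := by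
    intro x
    have e1 := hτ' x
    rw [hgk, map_add, map_mul, ← hb, hak] at e1
    have hu : IsUnit (Ideal.Quotient.mk (I₀ R) (k : R)) := k.isUnit.map _
    exact hu.mul_left_cancel (add_right_cancel e1)
  have hadd : ∀ x y, g (x + y) - g x - g y ∈ I₀ R := by
    intro x y
    rw [← Ideal.Quotient.eq_zero_iff_mem]
    simp only [map_sub, map_add, hgτ]
    ring
  have hmul : ∀ x y, g (x * y) - g x * g y ∈ I₀ R := by
    intro x y
    rw [← Ideal.Quotient.eq_zero_iff_mem]
    simp only [map_sub, map_mul, hgτ]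
    ring
  let φ : R →+* R :=
    { toFun := g
      map_one' := hg1
      map_zero' := hg0
      map_add' := hg.map_add hK hg0 hg1 hadd
      map_mul' := hg.map_mul hK hg0 hg1 hadd hmul }
  exact ⟨k, f 0, RingEquiv.ofBijective φ
    ⟨hg.injective, Finite.injective_iff_surjective.1 hg.injective⟩, hgk⟩

end Local

/-! ### Passage to the quotient ring -/

section Quotient

variable {R : Type*} [CommRing R] {K : Subgroup Rˣ}

theorem induced_le_aut (I : Ideal R) :
    induced (Ideal.Quotient.mk I) (aut (cyc K)) ≤ aut (cyc (imageUnits I K)) := by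
  rintro g ⟨f, hf, h⟩
  rw [mem_aut_cyc]
  intro X Y
  obtain ⟨x, rfl⟩ := Ideal.Quotient.mk_surjective X
  obtain ⟨y, rfl⟩ := Ideal.Quotient.mk_surjective Y
  obtain ⟨k, hk, e⟩ := mem_aut_cyc.1 hf x y
  refine ⟨_, Subgroup.mem_map_of_mem _ hk, ?_⟩
  rw [h, h, ← map_sub, e, map_mul, map_sub]
  rfl

/-- Each `σ x` is a unit multiple of `x`, so every ideal is invariant. -/
theorem map_eq_of_mem_ringAut (I : Ideal R) {σ : RingAut R} (hσ : σ ∈ ringAut (cyc K)) :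
    I = I.map (σ : R →+* R) := by
  have key : ∀ τ ∈ ringAut (cyc K), ∀ x ∈ I, τ x ∈ I := by
    intro τ hτ x hx
    have hp : Preserves K τ := mem_aut_cyc.1 hτ
    have := hp.sub_mem (I := I) (x := x) (y := 0) (by simpa using hx)
    simpa using this
  refine le_antisymm (fun x hx => ?_) (Ideal.map_le_iff_le_comap.2 (key σ hσ))
  have e : σ ((σ⁻¹ : RingAut R) x) = x := σ.apply_symm_apply x
  rw [← e]
  exact Ideal.mem_map_of_mem (σ : R →+* R) (key _ ((ringAut _).inv_mem hσ) x hx)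

/-- The homomorphism taking `σ` to the automorphism it induces modulo `I`. -/
def ringAutQuotient (K : Subgroup Rˣ) (I : Ideal R) :
    ringAut (cyc K) →* ringAut (factor (Ideal.Quotient.mk I) (cyc K)) where
  toFun σ := ⟨Ideal.quotientEquiv I I (σ : RingAut R) (map_eq_of_mem_ringAut I σ.2), by
    rintro _ ⟨S, hS, rfl⟩
    have h := σ.2 S hS
    conv_rhs => rw [← h]
    rw [← Set.image_comp]
    simp only
    rw [← Set.image_comp]
    rfl⟩
  map_one' := by
    ext X
    obtain ⟨x, rfl⟩ := Ideal.Quotient.mk_surjective X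
    rfl
  map_mul' σ τ := by
    ext X
    obtain ⟨x, rfl⟩ := Ideal.Quotient.mk_surjective X
    rfl

theorem ringAutQuotient_apply (I : Ideal R) (σ : ringAut (cyc K)) (x : R) :
    (ringAutQuotient K I σ : RingAut (R ⧸ I)) (Ideal.Quotient.mk I x) =
      Ideal.Quotient.mk I ((σ : RingAut R) x) := rfl

theorem ringAutQuotient_injective [Finite R] [IsLocalRing R] (hK : IsPure K) :
    Function.Injective (ringAutQuotient K (I₀ R)) := by
  rw [injective_iff_map_eq_one]
  intro σ hσ
  refine Subtype.ext (eq_one_of_sub_mem_I₀ hK (mem_aut_cyc.1 σ.2) fun x => ?_)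
  rw [← Ideal.Quotient.eq]
  have := ringAutQuotient_apply (I₀ R) σ x
  rw [hσ] at this
  exact this.symm

end Quotient

end CycScheme

theorem mainTheorem7 {R : Type*} [CommRing R] [Finite R] [IsLocalRing R]
    (K : Subgroup Rˣ) (hK : CycScheme.IsPure K) :
    (∃ φ : CycScheme.ringAut (CycScheme.cyc K) →*
          CycScheme.ringAut
            (CycScheme.factor (Ideal.Quotient.mk (CycScheme.I₀ R)) (CycScheme.cyc K)),
        (∀ (σ : CycScheme.ringAut (CycScheme.cyc K)) (x : R),
          (φ σ : RingAut (R ⧸ CycScheme.I₀ R)) (Ideal.Quotient.mk (CycScheme.I₀ R) x) =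
            Ideal.Quotient.mk (CycScheme.I₀ R) ((σ : RingAut R) x)) ∧
        Function.Injective φ) ∧
    (CycScheme.induced (Ideal.Quotient.mk (CycScheme.I₀ R)) (CycScheme.aut (CycScheme.cyc K)) ≤
          CycScheme.affineSemilinear (R ⧸ CycScheme.I₀ R) →
        CycScheme.aut (CycScheme.cyc K) ≤ CycScheme.affineSemilinear R) ∧
    (CycScheme.IsNormal (CycScheme.imageUnits (CycScheme.I₀ R) K) →
        CycScheme.IsNormal K) :=
  ⟨⟨CycScheme.ringAutQuotient K _, CycScheme.ringAutQuotient_apply _,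
      CycScheme.ringAutQuotient_injective hK⟩,
    CycScheme.aut_le_affineSemilinear hK,
    fun h => CycScheme.aut_le_affineSemilinear hK ((CycScheme.induced_le_aut _).trans h)⟩
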